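/- Let $n \ge 1$. In the real vector space $\mathbb{R}^n/\mathbb{R}(1,\dots,1)$, write $e_1,\dots,e_n$ for the images of the standard basis vectors. Let $A_{n-1}=\{e_i-e_j : 1\le i<j\le n\}$ be the set of positive roots of type $A$, and let $\Lambda_W=\mathbb{Z}\{e_1,\dots,e_n\}$ (so that $e_1+\cdots+e_n=0$) be its weight lattice. For a finite subset $A$ of a lattice $\Lambda$ of rank $d$, and $B\subseteq A$, let $r(B)=\dim_{\mathbb{R}}\operatorname{span}_{\mathbb{R}}B$, let $m(B)$ be the index of $\mathbb{Z}B$ in $\operatorname{span}_{\mathbb{R}}B\cap\Lambda$, let $$M_A(x,y)=\sum_{B\subseteq A}m(B)\,(x-1)^{r(A)-r(B)}(y-1)^{|B|-r(B)}$$ be the arithmetic Tutte polynomial of $A$, and let $$\chi_A(q)=(-1)^{r(A)}\,q^{\,d-r(A)}\,M_A(1-q,0)$$ be the arithmetic characteristic polynomial of $A$, all with respect to $\Lambda$. Let $\chi^W_{A_{n-1}}(q)$ be the arithmetic characteristic polynomial of $A_{n-1}$ with respect to $\Lambda_W$. Then $$\chi^W_{A_{n-1}}(q)=\frac{n!}{q}\sum_{m\mid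 n}(-1)^{n-\frac nm}\,\varphi(m)\binom{q/m}{n/m}$$ as rational functions of $q$ over $\mathbb{Q}$ (equivalently, for every $q\neq 0$ in every field of characteristic $0$). Here $\varphi$ is Euler's totient function, the sum is over the positive divisors $m$ of $n$, and $\binom{z}{k}=z(z-1)\cdots(z-k+1)/k!$. In particular, when $n\ge 3$ is prime, $$\chi^W_{A_{n-1}}(q)=(q-1)(q-2)\cdots(q-n+1)+(n-1)\,(n-1)!$$ as polynomials in $q$. -/

import Mathlib

open Polynomial

noncomputable section

namespace ArithTutte

section General

variable {V : Type*} [AddCommGroup V] [Module ℝ V]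

/-- The rank `r(B)` of a finite set of vectors: the dimension of its real span. -/
def rk (B : Finset V) : ℕ :=
  Module.finrank ℝ (Submodule.span ℝ (B : Set V))

/-- The multiplicity `m(B)` of `B` with respect to the lattice `L`: the index of the subgroup `ℤB`
generated by `B` inside `span B ∩ L`, where `span B` is the real span of `B`. -/
def latticeMult (L : Submodule ℤ V) (B : Finset V) : ℕ :=
  (Submodule.span ℤ (B : Set V)).toAddSubgroup.relIndex
    ((Submodule.span ℝ (B : Set V)).restrictScalars ℤ ⊓ L).toAddSubgroup

/-- The arithmetic Tutte polynomial
`M_A(x, y) = ∑_{B ⊆ A} m(B) (x - 1)^(r(A) - r(B)) (y - 1)^(|B| - r(B))`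
of a finite subset `A` of the lattice `L`; here `x = X 0` and `y = X 1`. The truncated subtractions
are honest since `r(B) ≤ r(A)` and `r(B) ≤ |B|`. -/
def arithTutte (L : Submodule ℤ V) (A : Finset V) : MvPolynomial (Fin 2) ℤ :=
  ∑ B ∈ A.powerset,
    MvPolynomial.C (latticeMult L B : ℤ) * (MvPolynomial.X 0 - 1) ^ (rk A - rk B) *
      (MvPolynomial.X 1 - 1) ^ (B.card - rk B)

/-- The arithmetic characteristic polynomial
`χ_A(q) = (-1)^r q^(d - r) M_A(1 - q, 0)`, where `r` is the rank of `A` and `d` is the rank of the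
lattice `L` containing `A`. -/
def arithCharPoly (L : Submodule ℤ V) (A : Finset V) : ℤ[X] :=
  (-1) ^ rk A * X ^ (Module.finrank ℤ L - rk A) *
    MvPolynomial.aeval ![1 - X, 0] (arithTutte L A)

end General

section TypeA

/-- The real vector space `ℝⁿ / ℝ(1, …, 1)`, in which the weight lattice of `A_{n-1}` lives. -/
abbrev TypeASpace (n : ℕ) : Type :=
  (Fin n → ℝ) ⧸ Submodule.span ℝ {(fun _ => 1 : Fin n → ℝ)}

/-- The class of the standard basis vector `e_i` in `ℝⁿ / ℝ(1, …, 1)`. -/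
def typeAe (n : ℕ) (i : Fin n) : TypeASpace n :=
  Submodule.Quotient.mk (Pi.single i 1)

/-- The weight lattice of `A_{n-1}`, that is `ℤ{e_1, …, e_n} / (e_1 + ⋯ + e_n = 0)`. -/
def typeAWeightLattice (n : ℕ) : Submodule ℤ (TypeASpace n) :=
  Submodule.span ℤ (Set.range (typeAe n))

open Classical in
/-- The (positive) roots `{e_i - e_j : i < j}` of type `A_{n-1}`. -/
def typeARoots (n : ℕ) : Finset (TypeASpace n) :=
  (Finset.univ.filter fun p : Fin n × Fin n => p.1 < p.2).image
    fun p => typeAe n p.1 - typeAe n p.2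

/-- The arithmetic characteristic polynomial of `A_{n-1}` in its weight lattice. -/
def typeAWeightCharPoly (n : ℕ) : ℤ[X] :=
  arithCharPoly (typeAWeightLattice n) (typeARoots n)

end TypeA

end ArithTutte

end

/-!
The finite field method. For `q` divisible by every `m(B)`, there are `q ^ (d - r(B)) m(B)`
homomorphisms `L → ℤ/q` that vanish on `B`, because `m(B)` is the order of the torsion subgroup of
`L / ℤB`. By inclusion-exclusion `χ(q)` is the number of homomorphisms that vanish at no element of
`A`. For the weight lattice and the roots of type `A` these are the injective `n`-tuples in `ℤ/q`
with sum zero. Detecting the zero sum by the characters `ψ` of `ℤ/q`, one of order `m` contributes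
`n!` times the coefficient of `X ^ n` in `∏_{s ∈ ℤ/q} (1 + ψ(s) X) = (1 - (-X) ^ m) ^ (q / m)`.
Both sides of the claim, multiplied by `q`, are polynomials in `q`, so it is enough that they agree
at infinitely many `q`.
-/

noncomputable section

namespace ArithTutte

open Module

section HomCount

instance hasEnoughRootsOfUnity_multiplicative_zmod (q : ℕ) [NeZero q] :
    HasEnoughRootsOfUnity (Multiplicative (ZMod q)) q where
  prim := ⟨.ofAdd 1, by
    have h := IsPrimitiveRoot.orderOf (Multiplicative.ofAdd (1 : ZMod q))
    rwa [orderOf_ofAdd_eq_addOrderOf, ZMod.addOrderOf_one] at h⟩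
  cyc := by
    have : IsCyclic (Multiplicative (ZMod q))ˣ := toUnits.isCyclic.mp inferInstance
    exact inferInstance

theorem card_linearMap_zmod_of_finite {T : Type*} [AddCommGroup T] [Finite T] {q : ℕ} [NeZero q]
    (hq : Nat.card T ∣ q) : Nat.card (T →ₗ[ℤ] ZMod q) = Nat.card T := by
  have hexp : Monoid.exponent (Multiplicative T) ∣ q :=
    Group.exponent_dvd_nat_card.trans hq
  have := HasEnoughRootsOfUnity.of_dvd (Multiplicative (ZMod q)) hexp
  rw [← Nat.card_congr (Multiplicative.toAdd (α := T)),
    ← CommGroup.card_monoidHom_of_hasEnoughRootsOfUnity (Multiplicative T)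
      (Multiplicative (ZMod q))]
  exact Nat.card_congr <| (addMonoidHomLequivInt ℤ).symm.toEquiv.trans <|
    AddMonoidHom.toMultiplicative.trans toUnits.monoidHomCongrRight.toEquiv

theorem card_linearMap_of_free (F M : Type*) [AddCommGroup F] [Module.Free ℤ F]
    [Module.Finite ℤ F] [AddCommGroup M] :
    Nat.card (F →ₗ[ℤ] M) = Nat.card M ^ finrank ℤ F := by
  rw [← Nat.card_congr ((Free.chooseBasis ℤ F).constr ℤ).toEquiv, Nat.card_fun,
    finrank_eq_card_chooseBasisIndex, Nat.card_eq_fintype_card (α := Free.ChooseBasisIndex ℤ F)]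

theorem nonempty_equiv_torsion_prod_quotient_torsion (R G : Type*) [CommRing R] [IsDomain R]
    [IsPrincipalIdealRing R] [AddCommGroup G] [Module R G] [Module.Finite R G] :
    Nonempty ((Submodule.torsion R G × (G ⧸ Submodule.torsion R G)) ≃ₗ[R] G) := by
  obtain ⟨s, hs⟩ :=
    projective_lifting_property _ LinearMap.id (Submodule.torsion R G).mkQ_surjective
  exact ⟨lequivProdOfRightSplitExact (Submodule.torsion R G).injective_subtype
    (by rw [Submodule.range_subtype, Submodule.ker_mkQ]) hs⟩

theorem card_linearMap_zmod {G : Type*} [AddCommGroup G] [Module.Finite ℤ G] {q : ℕ} [NeZero q]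
    (hq : Nat.card (Submodule.torsion ℤ G) ∣ q) :
    Nat.card (G →ₗ[ℤ] ZMod q) = q ^ finrank ℤ G * Nat.card (Submodule.torsion ℤ G) := by
  have : Finite (Submodule.torsion ℤ G) :=
    Nat.finite_of_card_ne_zero fun h => NeZero.ne q (zero_dvd_iff.mp (h ▸ hq))
  obtain ⟨e⟩ := nonempty_equiv_torsion_prod_quotient_torsion ℤ G
  rw [← Nat.card_congr ((LinearMap.coprodEquiv ℤ).trans (e.congrLeft (ZMod q) ℤ)).toEquiv,
    Nat.card_prod, card_linearMap_zmod_of_finite hq, card_linearMap_of_free, Nat.card_zmod,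
    finrank_quotient_eq_of_le_torsion le_rfl, mul_comm]

end HomCount

section LatticeQuotient

variable {V : Type*} [AddCommGroup V] {L : Submodule ℤ V}

/-- The group `L / ℤB`, whose torsion subgroup has order `m(B)`. -/
abbrev LatticeQuotient (L : Submodule ℤ V) (B : Finset V) : Type _ :=
  L ⧸ Submodule.span ℤ (L.subtype ⁻¹' (B : Set V))

theorem map_subtype_span_preimage {B : Finset V} (hB : (B : Set V) ⊆ L) :
    (Submodule.span ℤ (L.subtype ⁻¹' (B : Set V))).map L.subtype =
      Submodule.span ℤ (B : Set V) := by
  rw [Submodule.map_span, Set.image_preimage_eq_of_subset]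
  rwa [Submodule.coe_subtype, Subtype.range_coe]

/-- Homomorphisms out of `L ⧸ ℤB` are the homomorphisms out of `L` that kill `B`. -/
def latticeQuotientHomEquiv (L : Submodule ℤ V) (B : Finset V) (M : Type*) [AddCommGroup M] :
    (LatticeQuotient L B →ₗ[ℤ] M) ≃ {φ : L →ₗ[ℤ] M // ∀ x : L, (x : V) ∈ B → φ x = 0} where
  toFun ψ := ⟨ψ ∘ₗ Submodule.mkQ _, fun x hx => by
    rw [LinearMap.comp_apply, Submodule.mkQ_apply, (Submodule.Quotient.mk_eq_zero _).mpr, map_zero]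
    exact Submodule.subset_span hx⟩
  invFun φ := Submodule.liftQ _ φ.1 <| Submodule.span_le.mpr φ.2
  left_inv ψ := Submodule.linearMap_qext _ (Submodule.liftQ_mkQ _ _ _)
  right_inv φ := Subtype.ext (Submodule.liftQ_mkQ _ _ _)

end LatticeQuotient

section Rank

variable {V : Type*} [AddCommGroup V] [Module ℝ V]

theorem rk_le_card (B : Finset V) : rk B ≤ B.card :=
  finrank_span_finset_le_card B

theorem rk_mono {A B : Finset V} (h : B ⊆ A) : rk B ≤ rk A :=
  Submodule.finrank_mono (Submodule.span_mono (Finset.coe_subset.mpr h))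

end Rank

section Lattice

variable {V : Type*} [NormedAddCommGroup V] [NormedSpace ℝ V] [FiniteDimensional ℝ V]
  {L : Submodule ℤ V} [DiscreteTopology L]

theorem finrank_span_int_eq_rk {B : Finset V} (hB : (B : Set V) ⊆ L) :
    finrank ℤ (Submodule.span ℤ (B : Set V)) = rk B := by
  have hBL := Submodule.span_le.mpr hB
  have : DiscreteTopology (Submodule.span ℤ (B : Set V)) :=
    DiscreteTopology.of_subset (s := (L : Set V)) inferInstance hBL
  exact (Real.finrank_eq_int_finrank_of_discrete this).symm

variable [IsZLattice ℝ L]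

theorem exists_dual_extending (f : L →ₗ[ℤ] ℤ) : ∃ g : V →ₗ[ℝ] ℝ, ∀ x : L, g x = f x := by
  let b := Free.chooseBasis ℤ L
  let g : V →ₗ[ℝ] ℝ := (b.ofZLatticeBasis ℝ L).constr ℝ fun i => (f (b i) : ℝ)
  have h : g.restrictScalars ℤ ∘ₗ L.subtype = Algebra.linearMap ℤ ℝ ∘ₗ f :=
    b.ext fun i => by
      rw [LinearMap.comp_apply, LinearMap.restrictScalars_apply, Submodule.subtype_apply,
        ← b.ofZLatticeBasis_apply ℝ L, Basis.constr_basis]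
      rfl
  exact ⟨g, fun x => LinearMap.congr_fun h x⟩

theorem mem_torsion_latticeQuotient_iff {B : Finset V} (hB : (B : Set V) ⊆ L) (x : L) :
    (Submodule.Quotient.mk x : LatticeQuotient L B) ∈ Submodule.torsion ℤ (LatticeQuotient L B) ↔
      (x : V) ∈ Submodule.span ℝ (B : Set V) := by
  have := ZLattice.module_finite ℝ L
  constructor
  · intro hx
    obtain ⟨⟨n, hn⟩, hnx⟩ := (Submodule.mem_torsion_iff _).mp hx
    have hmem : n • (x : V) ∈ Submodule.span ℤ (B : Set V) :=
      map_subtype_span_preimage hB ▸ Submodule.mem_map_of_mem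
        ((Submodule.Quotient.mk_eq_zero (x := n • x) _).mp hnx)
    have hreal := Submodule.span_le_restrictScalars ℤ ℝ _ hmem
    rw [← Int.cast_smul_eq_zsmul ℝ] at hreal
    exact (Submodule.smul_mem_iff _ (Int.cast_ne_zero.mpr (nonZeroDivisors.ne_zero hn))).mp hreal
  · intro hx
    -- The quotient by the torsion is free, so it suffices that every integral functional on it
    -- kills `x`, and such a functional extends to a real one that vanishes on `span B`.
    rw [← Submodule.Quotient.mk_eq_zero, ← forall_dual_apply_eq_zero_iff ℤ]
    intro f
    obtain ⟨g, hg⟩ := exists_dual_extending (f ∘ₗ Submodule.mkQ _ ∘ₗ Submodule.mkQ _)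
    have hker : Submodule.span ℝ (B : Set V) ≤ LinearMap.ker g := by
      refine Submodule.span_le.mpr fun y hy => ?_
      have hy0 : (Submodule.Quotient.mk ⟨y, hB hy⟩ : LatticeQuotient L B) = 0 :=
        (Submodule.Quotient.mk_eq_zero _).mpr (Submodule.subset_span hy)
      rw [SetLike.mem_coe, LinearMap.mem_ker, hg ⟨y, hB hy⟩, LinearMap.comp_apply,
        LinearMap.comp_apply]
      simp only [Submodule.mkQ_apply, hy0, map_zero, Int.cast_zero]
    have hgx := hg x
    rw [LinearMap.mem_ker.mp (hker hx)] at hgx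
    exact_mod_cast hgx.symm

theorem latticeMult_eq_card_torsion {B : Finset V} (hB : (B : Set V) ⊆ L) :
    latticeMult L B = Nat.card (Submodule.torsion ℤ (LatticeQuotient L B)) := by
  let N := Submodule.span ℤ (L.subtype ⁻¹' (B : Set V))
  let S := ((Submodule.span ℝ (B : Set V)).restrictScalars ℤ).comap L.subtype
  have hN : N.map L.subtype = Submodule.span ℤ (B : Set V) := map_subtype_span_preimage hB
  have hS : S.map L.subtype = (Submodule.span ℝ (B : Set V)).restrictScalars ℤ ⊓ L := by
    rw [Submodule.map_comap_subtype, inf_comm]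
  have htorsion : S.map N.mkQ = Submodule.torsion ℤ (LatticeQuotient L B) := by
    rw [← Submodule.map_comap_eq_of_surjective N.mkQ_surjective (Submodule.torsion ℤ _)]
    congr 1
    ext x
    exact (mem_torsion_latticeQuotient_iff hB x).symm
  have hker : N.mkQ.toAddMonoidHom.ker = N.toAddSubgroup := by
    rw [← LinearMap.ker_toAddSubgroup, Submodule.ker_mkQ]
  calc latticeMult L B
      = (N.toAddSubgroup.map L.subtype.toAddMonoidHom).relIndex
          (S.toAddSubgroup.map L.subtype.toAddMonoidHom) := by
        rw [latticeMult, ← hN, ← hS, Submodule.map_toAddSubgroup, Submodule.map_toAddSubgroup]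
        rfl
    _ = N.toAddSubgroup.relIndex S.toAddSubgroup :=
        AddSubgroup.relIndex_map_map_of_injective _ _ L.injective_subtype
    _ = Nat.card (S.toAddSubgroup.map N.mkQ.toAddMonoidHom) := by
        rw [← hker, AddSubgroup.relIndex_ker]
    _ = Nat.card (Submodule.torsion ℤ (LatticeQuotient L B)) := by
        rw [← htorsion]
        rfl

theorem finrank_latticeQuotient {B : Finset V} (hB : (B : Set V) ⊆ L) :
    finrank ℤ (LatticeQuotient L B) = finrank ℤ L - rk B := by
  have := ZLattice.module_finite ℝ L
  rw [← finrank_span_int_eq_rk hB, ← map_subtype_span_preimage hB,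
    Submodule.finrank_map_subtype_eq,
    ← Submodule.finrank_quotient_add_finrank (Submodule.span ℤ (L.subtype ⁻¹' (B : Set V))),
    Nat.add_sub_cancel]

theorem latticeMult_ne_zero {B : Finset V} (hB : (B : Set V) ⊆ L) : latticeMult L B ≠ 0 := by
  have := ZLattice.module_finite ℝ L
  have : Finite (Submodule.torsion ℤ (LatticeQuotient L B)) :=
    Module.finite_of_fg_torsion _ Submodule.torsion_isTorsion
  rw [latticeMult_eq_card_torsion hB]
  exact Nat.card_pos.ne'

theorem exists_latticeMult_dvd {A : Finset V} (hA : (A : Set V) ⊆ L) :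
    ∃ N ≠ 0, ∀ B ⊆ A, latticeMult L B ∣ N :=
  ⟨∏ B ∈ A.powerset, latticeMult L B,
    Finset.prod_ne_zero_iff.mpr fun _ hB =>
      latticeMult_ne_zero ((Finset.coe_subset.mpr (Finset.mem_powerset.mp hB)).trans hA),
    fun _ hB => Finset.dvd_prod_of_mem _ (Finset.mem_powerset.mpr hB)⟩

theorem card_linearMap_zmod_vanishing {B : Finset V} (hB : (B : Set V) ⊆ L) {q : ℕ} [NeZero q]
    (hq : latticeMult L B ∣ q) :
    Nat.card {φ : L →ₗ[ℤ] ZMod q // ∀ x : L, (x : V) ∈ B → φ x = 0} =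
      q ^ (finrank ℤ L - rk B) * latticeMult L B := by
  have := ZLattice.module_finite ℝ L
  rw [latticeMult_eq_card_torsion hB] at hq ⊢
  rw [← Nat.card_congr (latticeQuotientHomEquiv L B (ZMod q)), card_linearMap_zmod hq,
    finrank_latticeQuotient hB]

theorem rk_le_finrank (A : Finset V) : rk A ≤ finrank ℤ L := by
  rw [ZLattice.rank ℝ L]
  exact Submodule.finrank_le _

variable (L) in
theorem arithCharPoly_eq_sum (A : Finset V) :
    arithCharPoly L A = ∑ B ∈ A.powerset,
      C ((-1) ^ B.card * (latticeMult L B : ℤ)) * X ^ (finrank ℤ L - rk B) := by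
  rw [arithCharPoly, arithTutte, map_sum, Finset.mul_sum]
  refine Finset.sum_congr rfl fun B hB => ?_
  obtain ⟨a, ha⟩ := Nat.exists_eq_add_of_le (rk_mono (Finset.mem_powerset.mp hB))
  obtain ⟨b, hb⟩ := Nat.exists_eq_add_of_le (rk_le_card B)
  obtain ⟨c, hc⟩ := Nat.exists_eq_add_of_le (rk_le_finrank (L := L) A)
  have hsign : ((-1 : ℤ[X]) ^ a) * (-1) ^ a = 1 := by rw [← mul_pow]; norm_num
  have hdB : finrank ℤ L - rk B = a + c := by omega
  have hdA : finrank ℤ L - rk A = c := by omega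
  have haB : rk A - rk B = a := by omega
  have hbB : B.card - rk B = b := by omega
  rw [hdB, hdA, haB, hbB, ha, hb]
  simp only [map_mul, map_pow, map_sub, map_one, map_neg, MvPolynomial.aeval_X,
    Matrix.cons_val_zero, Matrix.cons_val_one, map_natCast]
  rw [show (1 - X - 1 : ℤ[X]) = -1 * X by ring, mul_pow]
  linear_combination (-1) ^ (rk B + b) * (latticeMult L B : ℤ[X]) * X ^ (a + c) * hsign

theorem eval_arithCharPoly_eq_card {A : Finset V} (hA : (A : Set V) ⊆ L) {q : ℕ} [NeZero q]
    (hq : ∀ B ⊆ A, latticeMult L B ∣ q) :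
    (arithCharPoly L A).eval (q : ℤ) =
      Nat.card {φ : L →ₗ[ℤ] ZMod q // ∀ x : L, (x : V) ∈ A → φ x ≠ 0} := by
  classical
  have := ZLattice.module_finite ℝ L
  have := ZLattice.module_free ℝ L
  have : Finite (L →ₗ[ℤ] ZMod q) :=
    Nat.finite_of_card_ne_zero (by rw [card_linearMap_of_free, Nat.card_zmod]; simp [NeZero.ne q])
  have := Fintype.ofFinite (L →ₗ[ℤ] ZMod q)
  let Z (v : V) : Finset (L →ₗ[ℤ] ZMod q) := {φ | ∀ x : L, (x : V) = v → φ x = 0}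
  have hZ (B : Finset V) : ((B.inf Z).card : ℤ) =
      Nat.card {φ : L →ₗ[ℤ] ZMod q // ∀ x : L, (x : V) ∈ B → φ x = 0} := by
    rw [Nat.subtype_card]
    intro φ
    simp only [Z, Finset.mem_inf, Finset.mem_filter_univ]
    exact ⟨fun h x hx => h x hx x rfl, fun h v hv x hx => h x (hx ▸ hv)⟩
  have hcompl : (A.inf fun v => (Z v)ᶜ).card =
      Nat.card {φ : L →ₗ[ℤ] ZMod q // ∀ x : L, (x : V) ∈ A → φ x ≠ 0} := by
    rw [Nat.subtype_card]
    intro φ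
    simp only [Z, Finset.mem_inf, Finset.mem_compl, Finset.mem_filter_univ]
    exact ⟨fun h x hx h0 => h x hx fun y hy => Subtype.ext hy ▸ h0,
      fun h v hv h0 => h ⟨v, hA hv⟩ hv (h0 ⟨v, hA hv⟩ rfl)⟩
  rw [← hcompl, Finset.inclusion_exclusion_card_inf_compl, arithCharPoly_eq_sum, eval_finsetSum]
  refine Finset.sum_congr rfl fun B hB => ?_
  have hBA := Finset.mem_powerset.mp hB
  rw [hZ, card_linearMap_zmod_vanishing ((Finset.coe_subset.mpr hBA).trans hA) (hq B hBA)]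
  simp only [eval_mul, eval_C, eval_pow, eval_X, Nat.cast_mul, Nat.cast_pow]
  ring

end Lattice

section TypeA

theorem sum_typeAe (n : ℕ) : ∑ i, typeAe n i = 0 := by
  simp only [typeAe, ← Submodule.mkQ_apply, ← map_sum]
  rw [Submodule.mkQ_apply, Submodule.Quotient.mk_eq_zero,
    Finset.univ_sum_single (fun _ : Fin n => (1 : ℝ))]
  exact Submodule.mem_span_singleton_self _

theorem span_range_typeAe (n : ℕ) : Submodule.span ℝ (Set.range (typeAe n)) = ⊤ := by
  have hrange : Set.range (typeAe n) = Submodule.mkQ _ '' Set.range (Pi.basisFun ℝ (Fin n)) := by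
    rw [← Set.range_comp]
    congr
    funext i
    rw [Function.comp_apply, Pi.basisFun_apply]
    rfl
  rw [hrange, ← Submodule.map_span, Basis.span_eq, Submodule.map_top, Submodule.range_mkQ]

theorem typeAe_zero (k : ℕ) : typeAe (k + 1) 0 = -∑ i : Fin k, typeAe (k + 1) i.succ :=
  eq_neg_of_add_eq_zero_left ((Fin.sum_univ_succ _).symm.trans (sum_typeAe (k + 1)))

theorem finrank_typeASpace (k : ℕ) : finrank ℝ (TypeASpace (k + 1)) = k := by
  have h1 : (fun _ => 1 : Fin (k + 1) → ℝ) ≠ 0 := one_ne_zero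
  have h := Submodule.finrank_quotient_add_finrank
    (Submodule.span ℝ {(fun _ => 1 : Fin (k + 1) → ℝ)})
  rw [finrank_span_singleton h1, finrank_fin_fun] at h
  exact Nat.succ_injective h

theorem span_typeAe_succ (R : Type*) [Ring R] (k : ℕ) [Module R (TypeASpace (k + 1))] :
    Submodule.span R (Set.range fun i : Fin k => typeAe (k + 1) i.succ) =
      Submodule.span R (Set.range (typeAe (k + 1))) := by
  refine le_antisymm (Submodule.span_mono (Set.range_comp_subset_range _ (typeAe _)))
    (Submodule.span_le.mpr ?_)
  rintro _ ⟨i, rfl⟩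
  cases i using Fin.cases with
  | zero =>
    rw [typeAe_zero]
    exact Submodule.neg_mem _ (Submodule.sum_mem _ fun j _ => Submodule.subset_span ⟨j, rfl⟩)
  | succ j => exact Submodule.subset_span ⟨j, rfl⟩

/-- The basis `e_2, …, e_n` of `ℝⁿ / ℝ(1, …, 1)`, where `n = k + 1`. -/
def typeABasis (k : ℕ) : Basis (Fin k) ℝ (TypeASpace (k + 1)) :=
  basisOfTopLeSpanOfCardEqFinrank (fun i : Fin k => typeAe (k + 1) i.succ)
    (by rw [span_typeAe_succ, span_range_typeAe]) (by rw [finrank_typeASpace, Fintype.card_fin])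

theorem coe_typeABasis (k : ℕ) :
    (typeABasis k : Fin k → TypeASpace (k + 1)) = fun i => typeAe (k + 1) i.succ :=
  coe_basisOfTopLeSpanOfCardEqFinrank _ _ _

theorem typeAWeightLattice_eq (k : ℕ) :
    typeAWeightLattice (k + 1) = Submodule.span ℤ (Set.range (typeABasis k)) := by
  rw [coe_typeABasis, span_typeAe_succ, typeAWeightLattice]

instance isClosed_span_one (n : ℕ) :
    IsClosed (Submodule.span ℝ {(fun _ => 1 : Fin n → ℝ)} : Set (Fin n → ℝ)) :=
  Submodule.closed_of_finiteDimensional _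

instance discreteTopology_typeAWeightLattice (k : ℕ) :
    DiscreteTopology (typeAWeightLattice (k + 1)) := by
  rw [typeAWeightLattice_eq]
  infer_instance

instance isZLattice_typeAWeightLattice (k : ℕ) : IsZLattice ℝ (typeAWeightLattice (k + 1)) where
  span_top := by rw [typeAWeightLattice, Submodule.span_span_of_tower, span_range_typeAe]

/-- The vector `e_i` as an element of the weight lattice. -/
def typeAWeight (n : ℕ) (i : Fin n) : typeAWeightLattice n :=
  ⟨typeAe n i, Submodule.subset_span ⟨i, rfl⟩⟩

theorem typeAWeight_zero (k : ℕ) :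
    typeAWeight (k + 1) 0 = -∑ i : Fin k, typeAWeight (k + 1) i.succ := by
  apply Subtype.ext
  rw [Submodule.coe_neg, Submodule.coe_sum]
  exact typeAe_zero k

/-- The basis `e_2, …, e_n` of the weight lattice, where `n = k + 1`. -/
def typeAWeightBasis (k : ℕ) : Basis (Fin k) ℤ (typeAWeightLattice (k + 1)) :=
  ((typeABasis k).restrictScalars ℤ).map (LinearEquiv.ofEq _ _ (typeAWeightLattice_eq k).symm)

theorem typeAWeightBasis_apply (k : ℕ) (i : Fin k) :
    typeAWeightBasis k i = typeAWeight (k + 1) i.succ := by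
  apply Subtype.ext
  simp [typeAWeightBasis, coe_typeABasis, typeAWeight]

theorem mem_typeARoots {n : ℕ} {y : TypeASpace n} :
    y ∈ typeARoots n ↔ ∃ i j, i < j ∧ typeAe n i - typeAe n j = y := by
  simp [typeARoots]

theorem typeARoots_subset (n : ℕ) :
    (typeARoots n : Set (TypeASpace n)) ⊆ typeAWeightLattice n := by
  intro y hy
  obtain ⟨i, j, -, rfl⟩ := mem_typeARoots.mp hy
  exact (typeAWeight n i - typeAWeight n j).2

/-- Tuples with sum zero are determined by all their entries but the first. -/
def sumZeroEquiv (k : ℕ) (M : Type*) [AddCommGroup M] :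
    (Fin k → M) ≃ {x : Fin (k + 1) → M // ∑ i, x i = 0} where
  toFun x := ⟨Fin.cons (-∑ i, x i) x, by simp [Fin.sum_univ_succ]⟩
  invFun x := Fin.tail x.1
  left_inv x := Fin.tail_cons _ _
  right_inv x := by
    have h := x.2
    rw [Fin.sum_univ_succ] at h
    exact Subtype.ext ((congrArg (Fin.cons · _) (eq_neg_of_add_eq_zero_left h).symm).trans
      (Fin.cons_self_tail x.1))

/-- Homomorphisms `φ` out of the weight lattice correspond to the tuples `(φ e_1, …, φ e_n)`, which
are all the tuples with sum zero. -/
def typeAHomEquiv (k : ℕ) (M : Type*) [AddCommGroup M] :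
    (typeAWeightLattice (k + 1) →ₗ[ℤ] M) ≃ {x : Fin (k + 1) → M // ∑ i, x i = 0} :=
  ((typeAWeightBasis k).constr ℤ).symm.toEquiv.trans (sumZeroEquiv k M)

theorem typeAHomEquiv_apply (k : ℕ) {M : Type*} [AddCommGroup M]
    (φ : typeAWeightLattice (k + 1) →ₗ[ℤ] M) (i : Fin (k + 1)) :
    (typeAHomEquiv k M φ).1 i = φ (typeAWeight (k + 1) i) := by
  have hsucc (j : Fin k) :
      ((typeAWeightBasis k).constr ℤ).symm φ j = φ (typeAWeight (k + 1) j.succ) := by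
    rw [Basis.constr_symm_apply, typeAWeightBasis_apply]
  cases i using Fin.cases with
  | zero =>
    rw [typeAWeight_zero, map_neg, map_sum, ← Finset.sum_congr rfl fun j _ => hsucc j]
    rfl
  | succ j => exact hsucc j

theorem ne_zero_on_typeARoots_iff_injective {n : ℕ} {M : Type*} [AddCommGroup M]
    (φ : typeAWeightLattice n →ₗ[ℤ] M) :
    (∀ x : typeAWeightLattice n, (x : TypeASpace n) ∈ typeARoots n → φ x ≠ 0) ↔
      Function.Injective fun i => φ (typeAWeight n i) := by
  have hroot (x : typeAWeightLattice n) : (x : TypeASpace n) ∈ typeARoots n ↔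
      ∃ i j, i < j ∧ typeAWeight n i - typeAWeight n j = x := by
    simp only [mem_typeARoots, Subtype.ext_iff]
    rfl
  simp only [hroot]
  constructor
  · exact fun h => .of_lt_imp_ne fun i j hij =>
      sub_ne_zero.mp (map_sub φ _ _ ▸ h _ ⟨i, j, hij, rfl⟩)
  · rintro h _ ⟨i, j, hij, rfl⟩
    rw [map_sub]
    exact sub_ne_zero.mpr (h.ne hij.ne)

theorem card_hom_typeARoots (k q : ℕ) :
    Nat.card {φ : typeAWeightLattice (k + 1) →ₗ[ℤ] ZMod q //
        ∀ x : typeAWeightLattice (k + 1), (x : TypeASpace (k + 1)) ∈ typeARoots (k + 1) → φ x ≠ 0} =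
      Nat.card {x : Fin (k + 1) ↪ ZMod q // ∑ i, x i = 0} := by
  let sumZero (x : Fin (k + 1) → ZMod q) : Prop := ∑ i, x i = 0
  have hcomm : {x : Subtype sumZero // Function.Injective x.1} ≃
      {x : {x : Fin (k + 1) → ZMod q // Function.Injective x} // sumZero x.1} :=
    (Equiv.subtypeSubtypeEquivSubtypeInter sumZero Function.Injective).trans
      ((Equiv.subtypeEquivRight fun _ => and_comm).trans
        (Equiv.subtypeSubtypeEquivSubtypeInter Function.Injective sumZero).symm)
  refine Nat.card_congr (((typeAHomEquiv k (ZMod q)).subtypeEquiv fun φ => ?_).trans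
    (hcomm.trans ((Equiv.subtypeInjectiveEquivEmbedding _ _).subtypeEquiv fun _ => Iff.rfl)))
  rw [ne_zero_on_typeARoots_iff_injective, ← funext (typeAHomEquiv_apply k φ)]

theorem exists_eval_typeAWeightCharPoly (k : ℕ) : ∃ N ≠ 0, ∀ q : ℕ, q ≠ 0 → N ∣ q →
    (typeAWeightCharPoly (k + 1)).eval (q : ℤ) =
      Nat.card {x : Fin (k + 1) ↪ ZMod q // ∑ i, x i = 0} := by
  obtain ⟨N, hN, hdvd⟩ := exists_latticeMult_dvd (typeARoots_subset (k + 1))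
  refine ⟨N, hN, fun q hq hNq => ?_⟩
  have : NeZero q := ⟨hq⟩
  rw [typeAWeightCharPoly, eval_arithCharPoly_eq_card (typeARoots_subset _)
    fun B hB => (hdvd B hB).trans hNq, card_hom_typeARoots]

end TypeA

section Counting

theorem card_embedding_map_univ_eq {α : Type*} [Fintype α] [DecidableEq α] {n : ℕ} {S : Finset α}
    (hS : S.card = n) :
    (Finset.univ.filter fun x : Fin n ↪ α => Finset.univ.map x = S).card = n.factorial := by
  let e : {x : Fin n ↪ α // Finset.univ.map x = S} ≃ (Fin n ↪ S) :=
    { toFun x := x.1.codRestrict (S : Set α) fun i =>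
        (Finset.ext_iff.mp x.2 _).mp (Finset.mem_map_of_mem x.1 (Finset.mem_univ i))
      invFun f := ⟨f.trans (.subtype _), Finset.eq_of_subset_of_card_le
        (fun s hs => by
          obtain ⟨i, -, rfl⟩ := Finset.mem_map.mp hs
          exact (f i).2)
        (by rw [Finset.card_map, Finset.card_univ, Fintype.card_fin, hS])⟩
      left_inv _ := rfl
      right_inv _ := rfl }
  rw [← Fintype.card_subtype, Fintype.card_congr e, Fintype.card_embedding_eq, Fintype.card_coe,
    Fintype.card_fin, hS, Nat.descFactorial_self]

theorem sum_embedding_prod {α R : Type*} [Fintype α] [CommSemiring R] (n : ℕ) (f : α → R) :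
    ∑ x : Fin n ↪ α, ∏ i, f (x i) =
      n.factorial * ∑ S ∈ Finset.univ.powersetCard n, ∏ s ∈ S, f s := by
  classical
  have hmaps : ∀ x ∈ (Finset.univ : Finset (Fin n ↪ α)),
      Finset.univ.map x ∈ (Finset.univ : Finset α).powersetCard n := fun x _ =>
    Finset.mem_powersetCard_univ.mpr (by rw [Finset.card_map, Finset.card_univ, Fintype.card_fin])
  rw [← Finset.sum_fiberwise_of_maps_to hmaps, Finset.mul_sum]
  refine Finset.sum_congr rfl fun S hS => ?_
  calc ∑ x : Fin n ↪ α with Finset.univ.map x = S, ∏ i, f (x i)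
      = ∑ x : Fin n ↪ α with Finset.univ.map x = S, ∏ s ∈ S, f s :=
        Finset.sum_congr rfl fun x hx => by
          rw [← (Finset.mem_filter.mp hx).2, Finset.prod_map]
    _ = n.factorial * ∏ s ∈ S, f s := by
        rw [Finset.sum_const, card_embedding_map_univ_eq (Finset.mem_powersetCard_univ.mp hS),
          nsmul_eq_mul]

theorem coeff_prod_one_add_C_mul_X {α R : Type*} [Fintype α] [CommSemiring R] (n : ℕ) (f : α → R) :
    (∏ s, (1 + C (f s) * X)).coeff n = ∑ S ∈ Finset.univ.powersetCard n, ∏ s ∈ S, f s := by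
  classical
  rw [Finset.prod_one_add, finsetSum_coeff, Finset.powersetCard_eq_filter, Finset.sum_filter]
  refine Finset.sum_congr rfl fun S _ => ?_
  rw [Finset.prod_mul_distrib, Finset.prod_const, ← map_prod, coeff_C_mul_X_pow]
  exact if_congr eq_comm rfl rfl

section RootsOfUnity

variable {R : Type*} [CommRing R] [IsDomain R] {ζ : R} {m : ℕ} [NeZero m]

theorem prod_range_one_add_pow_mul (hζ : IsPrimitiveRoot ζ m) (x : R) :
    ∏ i ∈ Finset.range m, (1 + ζ ^ i * x) = 1 - (-x) ^ m := by
  have hm : 0 < m := NeZero.pos m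
  have hprod := hζ.pow_sub_pow_eq_prod_sub_mul 1 (-x) hm
  rw [one_pow] at hprod
  rw [hprod]
  refine Finset.prod_nbij (ζ ^ ·) (fun i _ => ?_) hζ.injOn_pow (fun z hz => ?_) fun i _ => by ring
  · rw [mem_nthRootsFinset hm, pow_right_comm, hζ.pow_eq_one, one_pow]
  · obtain ⟨i, hi, rfl⟩ := hζ.eq_pow_of_pow_eq_one ((mem_nthRootsFinset hm _).mp hz)
    exact ⟨i, Finset.mem_coe.mpr (Finset.mem_range.mpr hi), rfl⟩

theorem prod_range_mul_one_add_pow_mul (hζ : IsPrimitiveRoot ζ m) (x : R) (l : ℕ) :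
    ∏ i ∈ Finset.range (m * l), (1 + ζ ^ i * x) = (1 - (-x) ^ m) ^ l := by
  induction l with
  | zero => rw [mul_zero, Finset.prod_range_zero, pow_zero]
  | succ l ih =>
    rw [Nat.mul_succ, Finset.prod_range_add, ih, pow_succ, ← prod_range_one_add_pow_mul hζ]
    simp only [pow_add, pow_mul, hζ.pow_eq_one, one_pow, one_mul]

end RootsOfUnity

theorem coeff_one_sub_neg_X_pow_pow (R : Type*) [CommRing R] {m : ℕ} (hm : 0 < m) (l n : ℕ) :
    ((1 - (-X) ^ m : R[X]) ^ l).coeff n =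
      if m ∣ n then (-1) ^ (n - n / m) * (l.choose (n / m) : R) else 0 := by
  have hexpand : (1 - (-X) ^ m : R[X]) ^ l =
      expand R m (((1 + X) ^ l).comp (C (-(-1) ^ m) * X)) := by
    simp only [pow_comp, add_comp, one_comp, X_comp, map_pow, map_add, map_one, map_mul, map_neg,
      expand_X, neg_pow (X : R[X]) m]
    ring
  rw [hexpand, coeff_expand hm, comp_C_mul_X_coeff, coeff_one_add_X_pow]
  refine if_ctx_congr Iff.rfl (fun hdvd => ?_) fun _ => rfl
  obtain ⟨j, rfl⟩ := hdvd
  obtain ⟨k, rfl⟩ := Nat.exists_eq_succ_of_ne_zero hm.ne'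
  have hexp : k.succ * j - j = k * j := by rw [Nat.succ_mul, Nat.add_sub_cancel]
  have hbase : -(-1 : R) ^ k.succ = (-1) ^ k := by rw [pow_succ]; ring
  rw [Nat.mul_div_cancel_left _ hm, hexp, hbase, pow_mul, mul_comm]

theorem addChar_map_sum {A M ι : Type*} [AddCommMonoid A] [CommMonoid M] (ψ : AddChar A M)
    (s : Finset ι) (x : ι → A) : ψ (∑ i ∈ s, x i) = ∏ i ∈ s, ψ (x i) :=
  map_sum ψ.toAddMonoidHom x s

theorem sum_addOrderOf {G M : Type*} [AddGroup G] [IsAddCyclic G] [Fintype G] [AddCommMonoid M]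
    (F : ℕ → M) :
    ∑ a : G, F (addOrderOf a) = ∑ d ∈ (Fintype.card G).divisors, d.totient • F d := by
  classical
  have hmaps : ∀ a ∈ (Finset.univ : Finset G), addOrderOf a ∈ (Fintype.card G).divisors :=
    fun a _ => Nat.mem_divisors.mpr ⟨addOrderOf_dvd_card, Fintype.card_ne_zero⟩
  rw [← Finset.sum_fiberwise_of_maps_to hmaps]
  refine Finset.sum_congr rfl fun d hd => ?_
  rw [Finset.sum_congr rfl fun a ha => congrArg F (Finset.mem_filter.mp ha).2, Finset.sum_const,
    IsAddCyclic.card_addOrderOf_eq_totient (Nat.dvd_of_mem_divisors hd)]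

section ZMod

variable {q : ℕ} [NeZero q]

theorem isPrimitiveRoot_stdAddChar (a : ZMod q) :
    IsPrimitiveRoot (ZMod.stdAddChar a) (addOrderOf a) where
  pow_eq_one := by
    rw [← AddChar.map_nsmul_eq_pow, addOrderOf_nsmul_eq_zero, AddChar.map_zero_eq_one]
  dvd_of_pow_eq_one l hl := by
    rw [← AddChar.map_nsmul_eq_pow, ← AddChar.map_zero_eq_one (ZMod.stdAddChar (N := q))] at hl
    exact addOrderOf_dvd_of_nsmul_eq_zero (ZMod.injective_stdAddChar hl)

theorem prod_one_add_stdAddChar_mul (a : ZMod q) :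
    ∏ s : ZMod q, (1 + C (ZMod.stdAddChar (s * a)) * X) =
      (1 - (-X) ^ addOrderOf a) ^ (q / addOrderOf a) := by
  have hdvd : addOrderOf a ∣ q := by simpa only [ZMod.card] using addOrderOf_dvd_card (x := a)
  have : NeZero (addOrderOf a) := ⟨(addOrderOf_pos a).ne'⟩
  have hζ := (isPrimitiveRoot_stdAddChar a).map_of_injective (f := C) C_injective
  rw [← prod_range_mul_one_add_pow_mul hζ, Nat.mul_div_cancel' hdvd]
  refine Finset.prod_nbij' ZMod.val (fun i => (i : ZMod q))
    (fun s _ => Finset.mem_range.mpr s.val_lt) (fun _ _ => Finset.mem_univ _)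
    (fun s _ => ZMod.natCast_zmod_val s)
    (fun i hi => ZMod.val_cast_of_lt (Finset.mem_range.mp hi)) fun s _ => ?_
  rw [← C_pow, ← AddChar.map_nsmul_eq_pow, nsmul_eq_mul, ZMod.natCast_zmod_val]

theorem mul_card_fiber_zero_eq_sum_stdAddChar {β : Type*} [Fintype β] (g : β → ZMod q) :
    (q : ℂ) * Nat.card {x // g x = 0} = ∑ a : ZMod q, ∑ x, ZMod.stdAddChar (a * g x) := by
  classical
  rw [Finset.sum_comm]
  simp only [AddChar.sum_mulShift _ (ZMod.isPrimitive_stdAddChar q), ZMod.card]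
  rw [Nat.card_eq_fintype_card, Fintype.card_subtype, ← Finset.sum_boole, Finset.mul_sum]
  simp only [mul_ite, mul_one, mul_zero, Nat.cast_ite, Nat.cast_zero]

theorem sum_embedding_stdAddChar (n : ℕ) (a : ZMod q) :
    ∑ x : Fin n ↪ ZMod q, ZMod.stdAddChar (a * ∑ i, x i) =
      n.factorial * ((1 - (-X) ^ addOrderOf a : ℂ[X]) ^ (q / addOrderOf a)).coeff n := by
  rw [← prod_one_add_stdAddChar_mul, coeff_prod_one_add_C_mul_X, ← sum_embedding_prod]
  refine Finset.sum_congr rfl fun x _ => ?_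
  rw [Finset.mul_sum, addChar_map_sum]
  simp only [mul_comm a]

theorem mul_card_embedding_sum_eq_zero (n : ℕ) :
    (q : ℤ) * Nat.card {x : Fin n ↪ ZMod q // ∑ i, x i = 0} =
      n.factorial * ∑ m ∈ (n.gcd q).divisors,
        (-1) ^ (n - n / m) * (m.totient : ℤ) * ((q / m).choose (n / m) : ℤ) := by
  have hdiv : (n.gcd q).divisors = q.divisors.filter (· ∣ n) := by
    ext m
    rw [Nat.mem_divisors, Finset.mem_filter, Nat.mem_divisors, Nat.dvd_gcd_iff,
      and_iff_left (Nat.gcd_ne_zero_right (NeZero.ne q)), and_iff_left (NeZero.ne q), and_comm]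
  rw [hdiv, Finset.sum_filter]
  suffices h : (q : ℂ) * Nat.card {x : Fin n ↪ ZMod q // ∑ i, x i = 0} =
      n.factorial * ∑ m ∈ q.divisors, if m ∣ n then
        (-1) ^ (n - n / m) * (m.totient : ℂ) * ((q / m).choose (n / m) : ℂ) else 0 by
    exact_mod_cast h
  simp only [mul_card_fiber_zero_eq_sum_stdAddChar, sum_embedding_stdAddChar, ← Finset.mul_sum]
  rw [sum_addOrderOf fun m => ((1 - (-X) ^ m : ℂ[X]) ^ (q / m)).coeff n, ZMod.card]
  congr 1
  refine Finset.sum_congr rfl fun m hm => ?_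
  rw [coeff_one_sub_neg_X_pow_pow ℂ (Nat.pos_of_mem_divisors hm), nsmul_eq_mul, mul_ite, mul_zero]
  refine if_congr Iff.rfl ?_ rfl
  ring

end ZMod

end Counting

section CharPoly

theorem factorial_mul_choose {R : Type*} [CommRing R] [BinomialRing R] (r : R) (k : ℕ) :
    (k.factorial : R) * Ring.choose r k = (descPochhammer R k).eval r := by
  rw [← nsmul_eq_mul, ← Ring.descPochhammer_eq_factorial_smul_choose, ← aeval_eq_smeval,
    ← eval_map_algebraMap, descPochhammer_map]

theorem factorial_mul_choose_succ {R : Type*} [CommRing R] [BinomialRing R] (r : R) (k : ℕ) :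
    ((k + 1).factorial : R) * Ring.choose r (k + 1) = r * ∏ i ∈ Finset.Icc 1 k, (r - i) := by
  rw [factorial_mul_choose, descPochhammer_eval_eq_prod_range, Finset.range_eq_Ico,
    Finset.prod_eq_prod_Ico_succ_bot k.succ_pos, Nat.cast_zero, sub_zero]
  rfl

theorem eq_of_eval_natCast_multiples {R : Type*} [CommRing R] [IsDomain R] [CharZero R]
    {P Q : R[X]} {N : ℕ} (hN : N ≠ 0)
    (h : ∀ q : ℕ, q ≠ 0 → N ∣ q → P.eval (q : R) = Q.eval (q : R)) : P = Q := by
  refine eq_of_infinite_eval_eq P Q (Set.infinite_of_injective_forall_mem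
    (f := fun j : ℕ => ((N * (j + 1) : ℕ) : R)) (fun i j hij => ?_) fun j =>
      h _ (mul_ne_zero hN j.succ_ne_zero) (dvd_mul_right _ _))
  exact Nat.succ_injective (Nat.eq_of_mul_eq_mul_left (Nat.pos_of_ne_zero hN)
    (Nat.cast_injective hij))

variable {n : ℕ}

theorem exists_mul_eval_typeAWeightCharPoly (hn : n ≠ 0) : ∃ N ≠ 0, ∀ q : ℕ, q ≠ 0 → N ∣ q →
    (q : ℤ) * (typeAWeightCharPoly n).eval (q : ℤ) = n.factorial * ∑ m ∈ n.divisors,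
      (-1) ^ (n - n / m) * (m.totient : ℤ) * ((q / m).choose (n / m) : ℤ) := by
  obtain ⟨k, rfl⟩ := Nat.exists_eq_succ_of_ne_zero hn
  obtain ⟨N, hN, h⟩ := exists_eval_typeAWeightCharPoly k
  refine ⟨N * k.succ, mul_ne_zero hN hn, fun q hq hNq => ?_⟩
  have : NeZero q := ⟨hq⟩
  have hgcd : k.succ.gcd q = k.succ := Nat.gcd_eq_left ((dvd_mul_left _ _).trans hNq)
  rw [h q hq ((dvd_mul_right _ _).trans hNq), mul_card_embedding_sum_eq_zero, hgcd]

variable (K : Type*) [Field K]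

/-- The polynomial whose value at `z` is the binomial coefficient `z (z - 1) ⋯ (z - k + 1) / k!`. -/
def binomialPoly (k : ℕ) : K[X] :=
  C (k.factorial : K)⁻¹ * descPochhammer K k

/-- The polynomial `n! ∑_{m ∣ n} (-1)^(n - n/m) φ(m) binom(q/m, n/m)` in the variable `q`. -/
def totientBinomialPoly (n : ℕ) : K[X] :=
  C (n.factorial : K) * ∑ m ∈ n.divisors, C ((-1) ^ (n - n / m) * (m.totient : K)) *
    (binomialPoly K (n / m)).comp (C (m : K)⁻¹ * X)

variable {K} [CharZero K]

theorem eval_binomialPoly (k : ℕ) (r : K) : (binomialPoly K k).eval r = Ring.choose r k := by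
  rw [binomialPoly, eval_mul, eval_C, ← factorial_mul_choose,
    inv_mul_cancel_left₀ (Nat.cast_ne_zero.mpr k.factorial_ne_zero)]

theorem eval_totientBinomialPoly (n : ℕ) (q : K) :
    (totientBinomialPoly K n).eval q = n.factorial * ∑ m ∈ n.divisors,
      (-1) ^ (n - n / m) * (m.totient : K) * Ring.choose (q / (m : K)) (n / m) := by
  simp only [totientBinomialPoly, eval_mul, eval_C, eval_finsetSum, eval_comp, eval_X,
    eval_binomialPoly, div_eq_inv_mul]

theorem X_mul_map_typeAWeightCharPoly (hn : n ≠ 0) :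
    X * (typeAWeightCharPoly n).map (Int.castRingHom K) = totientBinomialPoly K n := by
  obtain ⟨N, hN, h⟩ := exists_mul_eval_typeAWeightCharPoly hn
  refine eq_of_eval_natCast_multiples (mul_ne_zero hN hn) fun q hq hNq => ?_
  have hchoose (m : ℕ) (hm : m ∈ n.divisors) :
      Ring.choose ((q : K) / m) (n / m) = ((q / m).choose (n / m) : K) := by
    have hmq : m ∣ q := (Nat.dvd_of_mem_divisors hm).trans ((dvd_mul_left _ _).trans hNq)
    rw [← Nat.cast_div hmq (Nat.cast_ne_zero.mpr (Nat.pos_of_mem_divisors hm).ne'),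
      Ring.choose_natCast]
  rw [eval_mul, eval_X, eval_natCast_map, eq_intCast, eval_totientBinomialPoly,
    Finset.sum_congr rfl fun m hm => by rw [hchoose m hm]]
  exact_mod_cast congrArg (Int.cast : ℤ → K) (h q hq ((dvd_mul_right _ _).trans hNq))

theorem mul_aeval_typeAWeightCharPoly (hn : n ≠ 0) (q : K) :
    q * aeval q (typeAWeightCharPoly n) = n.factorial * ∑ m ∈ n.divisors,
      (-1) ^ (n - n / m) * (m.totient : K) * Ring.choose (q / (m : K)) (n / m) := by
  rw [← eval_totientBinomialPoly, ← X_mul_map_typeAWeightCharPoly hn, eval_mul, eval_X,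
    ← eval_map_algebraMap]
  rfl

theorem typeAWeightCharPoly_of_prime (hodd : Odd n) (hp : n.Prime) :
    typeAWeightCharPoly n = (∏ i ∈ Finset.Icc 1 (n - 1), (X - C (i : ℤ))) +
      C (((n - 1) * (n - 1).factorial : ℕ) : ℤ) := by
  obtain ⟨k, rfl⟩ := Nat.exists_eq_succ_of_ne_zero hp.ne_zero
  have hsign : (-1 : ℚ) ^ k = 1 := (Nat.Odd.sub_odd hodd odd_one).neg_one_pow
  apply map_injective (Int.castRingHom ℚ) Int.cast_injective
  refine mul_left_cancel₀ X_ne_zero (Polynomial.funext fun r => ?_)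
  rw [X_mul_map_typeAWeightCharPoly hp.ne_zero, eval_totientBinomialPoly, hp.divisors,
    Finset.sum_pair hp.one_lt.ne]
  calc (k.succ.factorial : ℚ) * _
      = k.succ.factorial * Ring.choose r (k + 1) + k.succ.factorial * (k * (r / k.succ)) := by
        simp [Nat.totient_prime hp, Nat.div_self hp.pos, hsign, mul_add]
    _ = r * (∏ i ∈ Finset.Icc 1 k, (r - i) + k * k.factorial) := by
        rw [factorial_mul_choose_succ, Nat.factorial_succ]
        push_cast
        field_simp
    _ = _ := by
        simp [Polynomial.map_prod, eval_prod]

end CharPoly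

end ArithTutte

end

theorem theorem1p12 (n : ℕ) (hn : 1 ≤ n) :
    (∀ (K : Type*) [Field K] [CharZero K] (q : K), q ≠ 0 →
      Polynomial.aeval q (ArithTutte.typeAWeightCharPoly n) =
        (n.factorial : K) / q *
          ∑ m ∈ n.divisors,
            (-1) ^ (n - n / m) * (m.totient : K) * Ring.choose (q / (m : K)) (n / m)) ∧
    (3 ≤ n → n.Prime →
      ArithTutte.typeAWeightCharPoly n =
        (∏ i ∈ Finset.Icc 1 (n - 1), (Polynomial.X - Polynomial.C (i : ℤ))) +
          Polynomial.C (((n - 1) * (n - 1).factorial : ℕ) : ℤ)) := by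
  refine ⟨fun K _ _ q hq => ?_, fun h3 hp =>
    ArithTutte.typeAWeightCharPoly_of_prime (hp.odd_of_ne_two (by omega)) hp⟩
  rw [div_mul_eq_mul_div, ← ArithTutte.mul_aeval_typeAWeightCharPoly (by omega),
    mul_div_cancel_left₀ _ hq]
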